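/- Work in the triangular lattice with horizontal lattice lines. A lozenge is the union of two unit triangles sharing an edge. For a region $R$ (a finite union of unit triangles), $\mathrm{M}(R)$ is the number of lozenge tilings of $R$; if the lozenges carry weights, $\mathrm{M}(R)$ is the sum over all tilings of the product of the weights of their lozenges. Let $H_{a,b,c}$ be the lattice hexagon with side lengths $a,b,c,a,b,c$ in cyclic order, starting from the northwestern side. For $m,n\ge 1$ put $\kappa=\lfloor (m+1)/2\rfloor$ (with $n\ge\kappa$), and let $Q_{m,n}$ be the union of the unit triangles that lie completely inside the upper right quarter of $H_{m,\,2(n-\kappa)+1,\,m}$, cut out by its vertical and horizontal symmetry axes. Its bottom row contains exactly $n$ up-pointing unit triangles. * $QH_{m,n}(a_1,\dots,a_\kappa)$ is $Q_{m,n}$ with the $a_1$-st, ..., $a_\kappa$-th up-pointing unit triangles (counted from left to right) of its bottom removed. * $\overline{QH}_{2k,n}(a_1,\dots,a_k)$ is $QH_{2k,n}(a_1,\dots,a_k)$ in which each vertical rhombus (two unit triangles sharing a horizontal edge) on the left side, i.e. touching the vertical symmetry axis, has weight $1/2$ and every other lozenge has weight $1$. * $\overline{QH}_{2k+1,n}(a_1,\dots,a_k)$,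 for $a_k\le n-1$, is obtained from $Q_{2k+1,n}$ with the same weights (each vertical rhombus touching the vertical symmetry axis has weight $1/2$) by first removing the leftmost up-pointing unit triangle from the bottom and then removing the $a_1$-st, ..., $a_k$-th of the remaining $n-1$ up-pointing unit triangles of the bottom, counted from left to right. Put $$\mathrm{E}(a_1,\dots,a_k)=\frac{2^{k^2}}{0!\,2!\,4!\cdots(2k-2)!}\prod_{1\le i<j\le k}(a_j-a_i)\prod_{1\le i<j\le k}(a_i+a_j-1),$$ $$\mathrm{O}(a_1,\dots,a_k)=\frac{2^{k^2}}{1!\,3!\,5!\cdots(2k-1)!}\prod_{1\le i<j\le k}(a_j-a_i)\prod_{1\le i\le j\le k}(a_i+a_j-1),$$ $$\overline{\mathrm{E}}(a_1,\dots,a_k)=\frac{2^{k^2}a_1a_2\cdots a_k}{0!\,2!\,4!\cdots(2k-2)!}\prod_{1\le i<j\le k}(a_j-a_i)\prod_{1\le i\le j\le k}(a_i+a_j),$$ $$\overline{\mathrm{O}}(a_1,\dots,a_k)=\frac{2^{k^2}a_1a_2\cdots a_k}{1!\,3!\,5!\cdots(2k-1)!}\prod_{1\le i<j\le k}(a_j-a_i)\prod_{1\le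 i<j\le k}(a_i+a_j),$$ where empty products equal $1$. **Theorem.** Let $1\le k<n$ and let $1\le a_1<a_2<\dots<a_k\le n$ be integers. Then $$\mathrm{M}(QH_{2k-1,n}(a_1,\dots,a_k))=2^{-k^2}\,\mathrm{E}(a_1,\dots,a_k),$$ $$\mathrm{M}(QH_{2k,n}(a_1,\dots,a_k))=2^{-k^2}\,\overline{\mathrm{O}}(a_1,\dots,a_k),$$ $$\mathrm{M}(\overline{QH}_{2k+1,n}(a_1,\dots,a_k))=\frac{2^{-k(k+1)}}{(2k)!}\,\overline{\mathrm{E}}(a_1,\dots,a_k)\qquad\text{if } a_k\le n-1,$$ $$\mathrm{M}(\overline{QH}_{2k,n}(a_1,\dots,a_k))=2^{-k(k+1)}\,\mathrm{O}(a_1,\dots,a_k).$$ -/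

import Mathlib

namespace QuarteredHexagon

/-- The unit triangles of the triangular lattice. The lattice point `(i, j) : ℤ × ℤ` stands for
the point `i • (1, 0) + j • (1/2, √3/2)` of the plane, so that twice its horizontal Cartesian
coordinate is `2 * i + j` and its height is `j` (in units of `√3/2`). The triangle `⟨i, j, up⟩` is
one of the two halves of the unit rhombus whose lower left corner is `(i, j)`: the up-pointing one
if `up = true`, and the down-pointing one if `up = false`. -/
structure UnitTriangle where
  i : ℤ
  j : ℤ
  up : Bool
deriving DecidableEq

/-- The three corners of a unit triangle. -/
def UnitTriangle.vertices (t : UnitTriangle) : Finset (ℤ × ℤ) :=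
  if t.up then {(t.i, t.j), (t.i + 1, t.j), (t.i, t.j + 1)}
  else {(t.i + 1, t.j), (t.i, t.j + 1), (t.i + 1, t.j + 1)}

/-- Two unit triangles are adjacent if they share an edge, i.e. exactly two corners. -/
def Adjacent (s t : UnitTriangle) : Prop := (s.vertices ∩ t.vertices).card = 2

instance (s t : UnitTriangle) : Decidable (Adjacent s t) := by
  unfold Adjacent; infer_instance

/-- The lozenges (tiles) contained in the region `R`: the unions of two unit triangles of `R`
that share an edge. -/
def tilesIn (R : Finset UnitTriangle) : Finset (Finset UnitTriangle) :=
  ((R ×ˢ R).filter fun p => Adjacent p.1 p.2).image fun p => {p.1, p.2}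

/-- The (lozenge) tilings of `R`: the sets of tiles contained in `R` such that
each unit triangle of `R` is covered by exactly one tile of the set. -/
def tilings (R : Finset UnitTriangle) : Finset (Finset (Finset UnitTriangle)) :=
  (tilesIn R).powerset.filter fun T => ∀ s ∈ R, (T.filter fun t => s ∈ t).card = 1

/-- The number of tilings of `R`. -/
def numTilings (R : Finset UnitTriangle) : ℕ := (tilings R).card

/-- The tiling generating function of the region `R` whose tiles are weighted by `w`. -/
def weightedTilings (R : Finset UnitTriangle) (w : Finset UnitTriangle → ℚ) : ℚ :=
  ∑ T ∈ tilings R, ∏ t ∈ T, w t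

/-- The lattice points of the closed hexagon with side lengths `a, b, c, a, b, c` in cyclic order,
starting from the northwestern side; its southern side runs from `(0, 0)` to `(b, 0)`. -/
def InHexagon (a b c : ℤ) (p : ℤ × ℤ) : Prop :=
  0 ≤ p.2 ∧ p.2 ≤ a + c ∧ -c ≤ p.1 ∧ p.1 ≤ b ∧ 0 ≤ p.1 + p.2 ∧ p.1 + p.2 ≤ a + b

instance (a b c : ℤ) (p : ℤ × ℤ) : Decidable (InHexagon a b c p) := by
  unfold InHexagon; infer_instance

/-- The hexagon with side lengths `a, b, c, a, b, c`, as a set of unit triangles. -/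
noncomputable def hexagon (a b c : ℤ) : Finset UnitTriangle :=
  ((Finset.Icc (-c - 1) b ×ˢ Finset.Icc 0 (a + c) ×ˢ (Finset.univ : Finset Bool)).image
    fun p => ⟨p.1, p.2.1, p.2.2⟩).filter fun t => ∀ p ∈ t.vertices, InHexagon a b c p

/-- The length `2 (n - k) + 1`, with `k = ⌊(m + 1) / 2⌋`, of the horizontal sides of the hexagon
that is quartered. -/
def baseSide (m n : ℕ) : ℤ := 2 * ((n : ℤ) - ((m + 1) / 2 : ℕ)) + 1

/-- The unit triangles of the hexagon with sides `m, 2 (n - k) + 1, m, m, 2 (n - k) + 1, m` that lie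
completely inside its upper right quarter. The vertical symmetry axis of the hexagon is
`2 * i + j = 2 (n - k) + 1` and the horizontal one is `j = m`. -/
noncomputable def quarter (m n : ℕ) : Finset UnitTriangle :=
  (hexagon m (baseSide m n) m).filter fun t =>
    ∀ p ∈ t.vertices, baseSide m n ≤ 2 * p.1 + p.2 ∧ (m : ℤ) ≤ p.2

/-- The up-pointing unit triangles at the bottom of a region lying above the line `j = h`. -/
def bottomUp (h : ℤ) (R : Finset UnitTriangle) : Finset UnitTriangle :=
  R.filter fun t => t.up = true ∧ t.j = h

/-- The position (`1`, `2`, ...) of `t`, from left to right, among the up-pointing unit triangles at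
the bottom of `R`. -/
def position (h : ℤ) (R : Finset UnitTriangle) (t : UnitTriangle) : ℕ :=
  ((bottomUp h R).filter fun s => s.i ≤ t.i).card

/-- The region `R` with the up-pointing unit triangles at the positions `a 0, a 1, ...` of its
bottom removed. -/
def removeBottom (h : ℤ) (R : Finset UnitTriangle) {k : ℕ} (a : Fin k → ℕ) :
    Finset UnitTriangle :=
  R.filter fun t => ¬ (t ∈ bottomUp h R ∧ ∃ r, a r = position h R t)

/-- The quartered hexagon `QH_{m,n}(a)`. -/
noncomputable def QH (m n : ℕ) {k : ℕ} (a : Fin k → ℕ) : Finset UnitTriangle :=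
  removeBottom m (quarter m n) a

/-- For odd `m`, the region underlying the weighted quartered hexagon: the leftmost up-pointing unit
triangle is removed from the bottom of the quarter, and then the triangles at the positions
`a 0, a 1, ...` of the bottom of the resulting region are removed. -/
noncomputable def QHTrimmed (m n : ℕ) {k : ℕ} (a : Fin k → ℕ) : Finset UnitTriangle :=
  removeBottom m (removeBottom m (quarter m n) ![1]) a

/-- `t` is a vertical rhombus (two unit triangles sharing a horizontal edge) on the left side of
the quarter: the left endpoint of the shared edge lies on the vertical symmetry axis. -/
def IsLeftVertical (m n : ℕ) (t : Finset UnitTriangle) : Prop :=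
  ∃ s ∈ t, s.up = true ∧ 2 * s.i + s.j = baseSide m n ∧ (⟨s.i, s.j - 1, false⟩ : UnitTriangle) ∈ t

instance (m n : ℕ) (t : Finset UnitTriangle) : Decidable (IsLeftVertical m n t) := by
  unfold IsLeftVertical; infer_instance

/-- The weight of a tile: `1/2` for the vertical rhombi on the left side, `1` otherwise. -/
def leftWeight (m n : ℕ) (t : Finset UnitTriangle) : ℚ :=
  if IsLeftVertical m n t then 1 / 2 else 1

/-- The tiling generating function of the weighted quartered hexagon, `m` even. -/
noncomputable def overlineQHEven (m n : ℕ) {k : ℕ} (a : Fin k → ℕ) : ℚ :=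
  weightedTilings (QH m n a) (leftWeight m n)

/-- The tiling generating function of the weighted quartered hexagon, `m` odd. -/
noncomputable def overlineQHOdd (m n : ℕ) {k : ℕ} (a : Fin k → ℕ) : ℚ :=
  weightedTilings (QHTrimmed m n a) (leftWeight m n)

/-- `E(a_1, ..., a_k)`. -/
def E {k : ℕ} (a : Fin k → ℕ) : ℚ :=
  2 ^ (k ^ 2) / (∏ i ∈ Finset.range k, ((2 * i).factorial : ℚ)) *
    (∏ i, ∏ j ∈ Finset.Ioi i, ((a j : ℚ) - a i)) *
    (∏ i, ∏ j ∈ Finset.Ioi i, ((a i : ℚ) + a j - 1))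

/-- `O(a_1, ..., a_k)`. -/
def O {k : ℕ} (a : Fin k → ℕ) : ℚ :=
  2 ^ (k ^ 2) / (∏ i ∈ Finset.range k, ((2 * i + 1).factorial : ℚ)) *
    (∏ i, ∏ j ∈ Finset.Ioi i, ((a j : ℚ) - a i)) *
    (∏ i, ∏ j ∈ Finset.Ici i, ((a i : ℚ) + a j - 1))

/-- The function `E` with an overline. -/
def overlineE {k : ℕ} (a : Fin k → ℕ) : ℚ :=
  2 ^ (k ^ 2) * (∏ i, (a i : ℚ)) / (∏ i ∈ Finset.range k, ((2 * i).factorial : ℚ)) *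
    (∏ i, ∏ j ∈ Finset.Ioi i, ((a j : ℚ) - a i)) *
    (∏ i, ∏ j ∈ Finset.Ici i, ((a i : ℚ) + a j))

/-- The function `O` with an overline. -/
def overlineO {k : ℕ} (a : Fin k → ℕ) : ℚ :=
  2 ^ (k ^ 2) * (∏ i, (a i : ℚ)) / (∏ i ∈ Finset.range k, ((2 * i + 1).factorial : ℚ)) *
    (∏ i, ∏ j ∈ Finset.Ioi i, ((a j : ℚ) - a i)) *
    (∏ i, ∏ j ∈ Finset.Ioi i, ((a i : ℚ) + a j))

end QuarteredHexagon

namespace QuarteredHexagon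

/-! Sweep each horizontal row from left to right. The leftmost remaining triangle has at most two
possible partners, and a row turns out to be determined by its vertical rhombi: exactly one lies
between two consecutive removed up-pointing triangles, and none after the last
(`weightedTilings_partialRow_interlace`). These rhombi remove triangles from the row above, so
tilings become chains of interlacing integer sequences. A row at odd height starts with an
up-pointing triangle, and `c + 1` removed triangles pass to `c`. A row at even height starts with a
down-pointing triangle touching the axis; this acts like one more removed triangle just left of the
row, so the number is preserved, and only here does the weight `x` of the axis rhombi enter.

Working down from the top, the generating function above a row is a determinant in the positions of
its removed triangles (`weightedTilings_above_eq_det`). Indeed, a sum over interlacing sequences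
acts on the rows of a determinant independently, each entry telescopes, and row operations turn the
differences into values. The column functions `e c`, `o c` are thus iterated sums of the constant 1.
For `x = 1` they are the binomials C(p+c-1, 2c) and C(p+c, 2c+1); for `x = 1/2` they are the
averages of these polynomials at p and p-1.

Up to a factor depending only on the row and one depending only on the column, they are monic of
degree c in p(p-1), p² or (p-1)². Hence every determinant is of Vandermonde type
(`det_mul_prod_sub_div`), and its differences split into (a_j - a_i)(a_i + a_j - 1) or (a_j -
a_i)(a_i + a_j). -/

/-! ### Tilings and their expansion along one triangle -/

theorem mem_tilesIn {R : Finset UnitTriangle} {t : Finset UnitTriangle} :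
    t ∈ tilesIn R ↔ ∃ a ∈ R, ∃ b ∈ R, Adjacent a b ∧ t = {a, b} := by
  simp only [tilesIn, Finset.mem_image, Finset.mem_filter, Finset.mem_product, Prod.exists]
  constructor
  · rintro ⟨a, b, ⟨⟨ha, hb⟩, hab⟩, rfl⟩
    exact ⟨a, ha, b, hb, hab, rfl⟩
  · rintro ⟨a, ha, b, hb, hab, rfl⟩
    exact ⟨a, b, ⟨⟨ha, hb⟩, hab⟩, rfl⟩

theorem adjacent_comm {s t : UnitTriangle} : Adjacent s t ↔ Adjacent t s := by
  unfold Adjacent; rw [Finset.inter_comm]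

theorem mem_tilings {R : Finset UnitTriangle} {T : Finset (Finset UnitTriangle)} :
    T ∈ tilings R ↔ (∀ t ∈ T, ∃ a ∈ R, ∃ b ∈ R, Adjacent a b ∧ t = {a, b}) ∧
      ∀ s ∈ R, ∃ t ∈ T, s ∈ t ∧ ∀ t' ∈ T, s ∈ t' → t' = t := by
  simp only [tilings, Finset.mem_filter, Finset.mem_powerset, Finset.subset_iff, mem_tilesIn]
  refine and_congr Iff.rfl (forall₂_congr fun s _ => ?_)
  rw [Finset.card_eq_one]
  constructor
  · rintro ⟨t, ht⟩
    have h1 : t ∈ T.filter fun t => s ∈ t := by rw [ht]; simp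
    rw [Finset.mem_filter] at h1
    refine ⟨t, h1.1, h1.2, fun t' h' hs' => ?_⟩
    have : t' ∈ T.filter fun t => s ∈ t := Finset.mem_filter.2 ⟨h', hs'⟩
    rw [ht] at this
    simpa using this
  · rintro ⟨t, ht, hst, hu⟩
    refine ⟨t, ?_⟩
    ext t'
    simp only [Finset.mem_filter, Finset.mem_singleton]
    exact ⟨fun h => hu t' h.1 h.2, fun h => h ▸ ⟨ht, hst⟩⟩

/-- Expansion of the tiling generating function along the tiles containing a given triangle. -/
theorem weightedTilings_expand (R : Finset UnitTriangle) (w : Finset UnitTriangle → ℚ)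
    {s : UnitTriangle} (hs : s ∈ R) (hirr : ¬ Adjacent s s) :
    weightedTilings R w =
      ∑ u ∈ R.filter (Adjacent s), w {s, u} * weightedTilings (R \ {s, u}) w := by
  classical
  -- In each tiling `s` has exactly one partner `u`, so the inner sum has a single term; exchanging
  -- the sums then groups the tilings by that partner.
  have h1 : weightedTilings R w = ∑ T ∈ tilings R,
      ∑ u ∈ R.filter fun u => Adjacent s u ∧ {s, u} ∈ T, ∏ t ∈ T, w t := by
    refine Finset.sum_congr rfl fun T hT => ?_
    rw [Finset.sum_const]
    suffices h : (R.filter fun u => Adjacent s u ∧ {s, u} ∈ T).card = 1 by rw [h, one_smul]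
    rw [mem_tilings] at hT
    obtain ⟨t, ht, hst, hu⟩ := hT.2 s hs
    obtain ⟨a, ha, b, hb, hab, rfl⟩ := hT.1 t ht
    have key : ∃ u ∈ R, Adjacent s u ∧ ({a, b} : Finset UnitTriangle) = {s, u} := by
      rcases (by simpa using hst : s = a ∨ s = b) with rfl | rfl
      · exact ⟨b, hb, hab, rfl⟩
      · exact ⟨a, ha, adjacent_comm.1 hab, Finset.pair_comm _ _⟩
    obtain ⟨u, huR, hsu, e⟩ := key
    rw [e] at ht hu
    rw [Finset.card_eq_one]
    refine ⟨u, ?_⟩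
    ext v
    simp only [Finset.mem_filter, Finset.mem_singleton]
    constructor
    · rintro ⟨_, hsv, hv⟩
      have := hu _ hv (by simp)
      have hvm : v ∈ ({s, u} : Finset UnitTriangle) := by rw [← this]; simp
      rcases (by simpa using hvm : v = s ∨ v = u) with rfl | rfl
      · exact absurd hsv hirr
      · rfl
    · rintro rfl
      exact ⟨huR, hsu, ht⟩
  have h2 : weightedTilings R w = ∑ u ∈ R.filter (Adjacent s),
      ∑ T ∈ (tilings R).filter fun T => {s, u} ∈ T, ∏ t ∈ T, w t := by
    rw [h1]
    refine Finset.sum_comm' fun T u => ?_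
    simp only [Finset.mem_filter]
    tauto
  rw [h2]
  refine Finset.sum_congr rfl fun u hu => ?_
  rw [Finset.mem_filter] at hu
  obtain ⟨huR, hsu⟩ := hu
  rw [weightedTilings, Finset.mul_sum]
  refine Finset.sum_bij' (fun T _ => T.erase {s, u}) (fun T _ => insert {s, u} T) ?_ ?_ ?_ ?_ ?_
  · intro T hT
    rw [Finset.mem_filter, mem_tilings] at hT
    obtain ⟨⟨hT1, hT2⟩, hT3⟩ := hT
    have uniq : ∀ t ∈ T, (s ∈ t ∨ u ∈ t) → t = {s, u} := by
      rintro t ht (h | h)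
      · obtain ⟨t', _, _, h'⟩ := hT2 s hs
        rw [h' t ht h, ← h' _ hT3 (by simp)]
      · obtain ⟨t', _, _, h'⟩ := hT2 u huR
        rw [h' t ht h, ← h' _ hT3 (by simp)]
    rw [mem_tilings]
    constructor
    · intro t ht
      rw [Finset.mem_erase] at ht
      obtain ⟨a, ha, b, hb, hab, rfl⟩ := hT1 t ht.2
      have hns : ¬ (s ∈ ({a, b} : Finset UnitTriangle) ∨ u ∈ ({a, b} : Finset UnitTriangle)) :=
        fun h => ht.1 (uniq _ ht.2 h)
      simp only [Finset.mem_insert, Finset.mem_singleton, not_or] at hns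
      refine ⟨a, ?_, b, ?_, hab, rfl⟩
      · simp only [Finset.mem_sdiff, Finset.mem_insert, Finset.mem_singleton, not_or]
        exact ⟨ha, fun h => hns.1.1 h.symm, fun h => hns.2.1 h.symm⟩
      · simp only [Finset.mem_sdiff, Finset.mem_insert, Finset.mem_singleton, not_or]
        exact ⟨hb, fun h => hns.1.2 h.symm, fun h => hns.2.2 h.symm⟩
    · intro r hr
      rw [Finset.mem_sdiff] at hr
      obtain ⟨t, ht, hrt, h'⟩ := hT2 r hr.1
      refine ⟨t, Finset.mem_erase.2 ⟨?_, ht⟩, hrt, fun t' ht' => h' t' (Finset.mem_of_mem_erase ht')⟩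
      rintro rfl
      exact hr.2 hrt
  · intro T hT
    rw [mem_tilings] at hT
    obtain ⟨hT1, hT2⟩ := hT
    have avoid : ∀ t ∈ T, ∀ r ∈ t, r ∈ R ∧ r ∉ ({s, u} : Finset UnitTriangle) := by
      intro t ht r hr
      obtain ⟨a, ha, b, hb, hab, rfl⟩ := hT1 t ht
      rcases (by simpa using hr : r = a ∨ r = b) with rfl | rfl
      · exact Finset.mem_sdiff.1 ha
      · exact Finset.mem_sdiff.1 hb
    rw [Finset.mem_filter, mem_tilings]
    refine ⟨⟨?_, ?_⟩, Finset.mem_insert_self _ _⟩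
    · intro t ht
      rcases Finset.mem_insert.1 ht with rfl | ht
      · exact ⟨s, hs, u, huR, hsu, rfl⟩
      · obtain ⟨a, ha, b, hb, hab, rfl⟩ := hT1 t ht
        exact ⟨a, (Finset.mem_sdiff.1 ha).1, b, (Finset.mem_sdiff.1 hb).1, hab, rfl⟩
    · intro r hr
      by_cases hrs : r ∈ ({s, u} : Finset UnitTriangle)
      · refine ⟨{s, u}, Finset.mem_insert_self _ _, hrs, fun t' ht' hrt' => ?_⟩
        rcases Finset.mem_insert.1 ht' with rfl | ht'
        · rfl
        · exact absurd hrs (avoid t' ht' r hrt').2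
      · obtain ⟨t, ht, hrt, h'⟩ := hT2 r (Finset.mem_sdiff.2 ⟨hr, hrs⟩)
        refine ⟨t, Finset.mem_insert_of_mem ht, hrt, fun t' ht' hrt' => ?_⟩
        rcases Finset.mem_insert.1 ht' with rfl | ht'
        · exact absurd hrt' hrs
        · exact h' t' ht' hrt'
  · intro T hT
    exact Finset.insert_erase (Finset.mem_filter.1 hT).2
  · intro T hT
    refine Finset.erase_insert fun h => ?_
    rw [mem_tilings] at hT
    obtain ⟨a, ha, b, hb, hab, e⟩ := hT.1 _ h
    have : s ∈ ({a, b} : Finset UnitTriangle) := by rw [← e]; simp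
    rcases (by simpa using this : s = a ∨ s = b) with rfl | rfl
    · simp at ha
    · simp at hb
  · intro T hT
    exact (Finset.mul_prod_erase T w (Finset.mem_filter.1 hT).2).symm

theorem weightedTilings_empty (w : Finset UnitTriangle → ℚ) : weightedTilings ∅ w = 1 := by
  have : tilings ∅ = {∅} := by
    ext T
    rw [mem_tilings, Finset.mem_singleton]
    constructor
    · rintro ⟨h, _⟩
      refine Finset.eq_empty_of_forall_notMem fun t ht => ?_
      obtain ⟨a, ha, _⟩ := h t ht
      simp at ha
    · rintro rfl
      simp
  rw [weightedTilings, this]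
  simp

theorem numTilings_eq_weightedTilings (R : Finset UnitTriangle) :
    (numTilings R : ℚ) = weightedTilings R fun _ => 1 := by
  simp [numTilings, weightedTilings]

/-! ### Adjacency and the quarter in coordinates -/

theorem adjacent_up_iff (i j : ℤ) (t : UnitTriangle) :
    Adjacent ⟨i, j, true⟩ t ↔ t = ⟨i, j, false⟩ ∨ t = ⟨i - 1, j, false⟩ ∨ t = ⟨i, j - 1, false⟩ := by
  obtain ⟨i', j', u⟩ := t
  have key : (⟨i, j, true⟩ : UnitTriangle).vertices = {(i, j), (i + 1, j), (i, j + 1)} := by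
    simp [UnitTriangle.vertices]
  unfold Adjacent
  rw [key, ← Finset.filter_mem_eq_inter]
  cases u
  · simp only [UnitTriangle.vertices, Finset.filter_insert, Finset.filter_singleton,
      Finset.mem_insert, Finset.mem_singleton, Prod.mk.injEq, UnitTriangle.mk.injEq, and_true,
      Bool.false_eq_true, if_false]
    split_ifs <;> simp [Finset.card_insert_of_notMem] <;> omega
  · simp only [UnitTriangle.vertices, Finset.filter_insert, Finset.filter_singleton,
      Finset.mem_insert, Finset.mem_singleton, Prod.mk.injEq, UnitTriangle.mk.injEq, if_true]
    split_ifs <;> simp [Finset.card_insert_of_notMem] <;> omega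

theorem adjacent_down_iff (i j : ℤ) (t : UnitTriangle) :
    Adjacent ⟨i, j, false⟩ t ↔ t = ⟨i, j, true⟩ ∨ t = ⟨i + 1, j, true⟩ ∨ t = ⟨i, j + 1, true⟩ := by
  obtain ⟨i', j', u⟩ := t
  cases u
  · have key : (⟨i, j, false⟩ : UnitTriangle).vertices =
        {(i + 1, j), (i, j + 1), (i + 1, j + 1)} := by
      simp [UnitTriangle.vertices]
    unfold Adjacent
    rw [key, ← Finset.filter_mem_eq_inter]
    simp only [UnitTriangle.vertices, Finset.filter_insert, Finset.filter_singleton,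
      Finset.mem_insert, Finset.mem_singleton, Prod.mk.injEq, UnitTriangle.mk.injEq,
      Bool.false_eq_true, if_false]
    split_ifs <;> simp [Finset.card_insert_of_notMem] <;> omega
  · rw [adjacent_comm, adjacent_up_iff]
    simp only [UnitTriangle.mk.injEq, and_true]
    omega

theorem mem_quarter_up {m n : ℕ} (h : 1 ≤ baseSide m n) (i j : ℤ) :
    (⟨i, j, true⟩ : UnitTriangle) ∈ quarter m n ↔
      baseSide m n ≤ 2 * i + j ∧ (m : ℤ) ≤ j ∧ i + 1 + j ≤ m + baseSide m n ∧ j + 1 ≤ 2 * m := by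
  rw [quarter, Finset.mem_filter, hexagon, Finset.mem_filter, Finset.mem_image]
  simp only [Finset.mem_product, Finset.mem_Icc, Finset.mem_univ, UnitTriangle.vertices,
    Finset.forall_mem_insert, Finset.mem_singleton, forall_eq, InHexagon, if_true,
    UnitTriangle.mk.injEq, Prod.exists, and_true]
  constructor
  · rintro ⟨⟨-, h1⟩, h2⟩
    omega
  · intro h1
    refine ⟨⟨⟨i, j, true, ?_, rfl, rfl, rfl⟩, ?_⟩, ?_⟩
    all_goals omega

theorem mem_quarter_down {m n : ℕ} (h : 1 ≤ baseSide m n) (i j : ℤ) :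
    (⟨i, j, false⟩ : UnitTriangle) ∈ quarter m n ↔
      baseSide m n ≤ 2 * i + j + 1 ∧ (m : ℤ) ≤ j ∧ i + 2 + j ≤ m + baseSide m n ∧
        j + 1 ≤ 2 * m := by
  rw [quarter, Finset.mem_filter, hexagon, Finset.mem_filter, Finset.mem_image]
  simp only [Finset.mem_product, Finset.mem_Icc, Finset.mem_univ, UnitTriangle.vertices,
    Finset.forall_mem_insert, Finset.mem_singleton, forall_eq, InHexagon, Bool.false_eq_true, if_false,
    UnitTriangle.mk.injEq, Prod.exists, and_true]
  constructor
  · rintro ⟨⟨-, h1⟩, h2⟩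
    omega
  · intro h1
    refine ⟨⟨⟨i, j, false, ?_, rfl, rfl, rfl⟩, ?_⟩, ?_⟩
    all_goals omega

/-- The weight `w` gives `x` to the vertical rhombi touching the line `2 * i + j = β`,
and `1` to all other tiles. -/
structure IsAxisWeight (w : Finset UnitTriangle → ℚ) (β : ℤ) (x : ℚ) : Prop where
  right : ∀ i j : ℤ, w {⟨i, j, true⟩, ⟨i, j, false⟩} = 1
  left : ∀ i j : ℤ, w {⟨i, j, false⟩, ⟨i + 1, j, true⟩} = 1
  vertical : ∀ i j : ℤ,
    w {⟨i, j, false⟩, ⟨i, j + 1, true⟩} = if 2 * i + j + 1 = β then x else 1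

theorem weightedTilings_expand_up (R : Finset UnitTriangle) (w : Finset UnitTriangle → ℚ) {i j : ℤ}
    (h : ⟨i, j, true⟩ ∈ R) (h1 : ⟨i - 1, j, false⟩ ∉ R) (h2 : ⟨i, j - 1, false⟩ ∉ R) :
    weightedTilings R w = if ⟨i, j, false⟩ ∈ R then w {⟨i, j, true⟩, ⟨i, j, false⟩} *
      weightedTilings (R \ {⟨i, j, true⟩, ⟨i, j, false⟩}) w else 0 := by
  rw [weightedTilings_expand R w h (by simp [adjacent_up_iff])]
  have : R.filter (Adjacent ⟨i, j, true⟩) =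
      ({⟨i, j, false⟩} : Finset UnitTriangle).filter (· ∈ R) := by
    ext t
    simp only [Finset.mem_filter, adjacent_up_iff, Finset.mem_singleton]
    grind
  rw [this, Finset.sum_filter, Finset.sum_singleton]

theorem weightedTilings_expand_down (R : Finset UnitTriangle) (w : Finset UnitTriangle → ℚ)
    {i j : ℤ} (h : ⟨i, j, false⟩ ∈ R) (h1 : ⟨i, j, true⟩ ∉ R) :
    weightedTilings R w =
      (if ⟨i + 1, j, true⟩ ∈ R then w {⟨i, j, false⟩, ⟨i + 1, j, true⟩} *
        weightedTilings (R \ {⟨i, j, false⟩, ⟨i + 1, j, true⟩}) w else 0) +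
      if ⟨i, j + 1, true⟩ ∈ R then w {⟨i, j, false⟩, ⟨i, j + 1, true⟩} *
        weightedTilings (R \ {⟨i, j, false⟩, ⟨i, j + 1, true⟩}) w else 0 := by
  rw [weightedTilings_expand R w h (by simp [adjacent_down_iff])]
  have : R.filter (Adjacent ⟨i, j, false⟩) =
      ({⟨i + 1, j, true⟩, ⟨i, j + 1, true⟩} : Finset UnitTriangle).filter (· ∈ R) := by
    ext t
    simp only [Finset.mem_filter, adjacent_down_iff, Finset.mem_singleton, Finset.mem_insert]
    grind
  rw [this, Finset.sum_filter, Finset.sum_pair (by simp)]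

/-! ### Sweeping one row from left to right -/

/-- The part of the quarter above the line of height `j`, without the up-pointing triangles of its
bottom row whose abscissa lies in `A`. -/
noncomputable def above (m n : ℕ) (j : ℤ) (A : Finset ℤ) : Finset UnitTriangle :=
  (quarter m n).filter fun t => j ≤ t.j ∧ (t.j = j → t.up = true → t.i ∉ A)

/-- The region `above m n j A` in which only the up-pointing triangles with abscissa at least `u`
and the down-pointing ones with abscissa at least `d` are kept in the bottom row, and in which the
up-pointing triangles with abscissa in `B` are removed from the next row. -/
noncomputable def partialRow (m n : ℕ) (j u d : ℤ) (A B : Finset ℤ) : Finset UnitTriangle :=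
  (quarter m n).filter fun t => j ≤ t.j ∧
    (t.j = j → t.up = true → u ≤ t.i ∧ t.i ∉ A) ∧ (t.j = j → t.up = false → d ≤ t.i) ∧
      (t.j = j + 1 → t.up = true → t.i ∉ B)

section
variable {m n : ℕ} {w : Finset UnitTriangle → ℚ} {x : ℚ} {j : ℤ} {A B : Finset ℤ}

theorem mem_partialRow_up (h : 1 ≤ baseSide m n) {u d i j' : ℤ} :
    (⟨i, j', true⟩ : UnitTriangle) ∈ partialRow m n j u d A B ↔
      (baseSide m n ≤ 2 * i + j' ∧ (m : ℤ) ≤ j' ∧ i + 1 + j' ≤ m + baseSide m n ∧ j' + 1 ≤ 2 * m) ∧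
      j ≤ j' ∧ (j' = j → u ≤ i ∧ i ∉ A) ∧ (j' = j + 1 → i ∉ B) := by
  simp [partialRow, mem_quarter_up h]

theorem mem_partialRow_down (h : 1 ≤ baseSide m n) {u d i j' : ℤ} :
    (⟨i, j', false⟩ : UnitTriangle) ∈ partialRow m n j u d A B ↔
      (baseSide m n ≤ 2 * i + j' + 1 ∧ (m : ℤ) ≤ j' ∧ i + 2 + j' ≤ m + baseSide m n ∧
        j' + 1 ≤ 2 * m) ∧ j ≤ j' ∧ (j' = j → d ≤ i) := by
  simp [partialRow, mem_quarter_down h]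

/-- With everything to its left gone, an up-pointing triangle can only be paired with the
down-pointing one on its right. The value 0 occurs when it is the last triangle of its row. -/
theorem weightedTilings_partialRow_up (hβ : 1 ≤ baseSide m n)
    (hw : IsAxisWeight w (baseSide m n) x) (hj : (m : ℤ) ≤ j) (hj' : j + 1 ≤ 2 * m) {p : ℤ}
    (hp : p ∉ A) (hl : baseSide m n ≤ 2 * p + j) (hr : p + 1 + j ≤ m + baseSide m n) :
    weightedTilings (partialRow m n j p p A B) w =
      if p + 2 + j ≤ m + baseSide m n then
        weightedTilings (partialRow m n j (p + 1) (p + 1) A B) w else 0 := by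
  rw [weightedTilings_expand_up (i := p) (j := j)]
  · have : (⟨p, j, false⟩ : UnitTriangle) ∈ partialRow m n j p p A B ↔
        p + 2 + j ≤ m + baseSide m n := by
      rw [mem_partialRow_down hβ]; omega
    rw [hw.right, one_mul, if_congr this rfl rfl]
    split_ifs with h
    · congr 1
      ext ⟨i', j', u⟩
      cases u
      · simp only [Finset.mem_sdiff, mem_partialRow_down hβ, Finset.mem_insert,
          Finset.mem_singleton, UnitTriangle.mk.injEq]
        grind
      · simp only [Finset.mem_sdiff, mem_partialRow_up hβ, Finset.mem_insert,
          Finset.mem_singleton, UnitTriangle.mk.injEq]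
        grind
    · rfl
  · rw [mem_partialRow_up hβ]; grind
  · rw [mem_partialRow_down hβ]; grind
  · rw [mem_partialRow_down hβ]; grind

theorem partialRow_of_mem (hβ : 1 ≤ baseSide m n) {p d : ℤ} (hp : p ∈ A) :
    partialRow m n j p d A B = partialRow m n j (p + 1) d A B := by
  ext ⟨i', j', u⟩
  cases u
  · simp only [mem_partialRow_down hβ]
  · simp only [mem_partialRow_up hβ]
    grind

theorem partialRow_sdiff_left (hβ : 1 ≤ baseSide m n) {p : ℤ} :
    partialRow m n j (p + 1) p A B \ {⟨p, j, false⟩, ⟨p + 1, j, true⟩} =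
      partialRow m n j (p + 2) (p + 1) A B := by
  ext ⟨i', j', u⟩
  cases u
  · simp only [Finset.mem_sdiff, mem_partialRow_down hβ, Finset.mem_insert,
      Finset.mem_singleton, UnitTriangle.mk.injEq, Bool.false_eq_true, and_false, and_true, or_false,
      imp_iff_not_or]
    omega
  · simp only [Finset.mem_sdiff, mem_partialRow_up hβ, Finset.mem_insert,
      Finset.mem_singleton, UnitTriangle.mk.injEq, Bool.true_eq_false, and_false, and_true,
      false_or]
    have : (p + 1 ≤ i' ∧ i' ≠ p + 1) ↔ p + 2 ≤ i' := by omega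
    by_cases hj : j' = j
    · simp only [hj, ← this]
      tauto
    · simp only [hj, and_false, false_imp_iff, not_false_eq_true, and_true]

theorem partialRow_sdiff_vertical (hβ : 1 ≤ baseSide m n) {p : ℤ} :
    partialRow m n j (p + 1) p A B \ {⟨p, j, false⟩, ⟨p, j + 1, true⟩} =
      partialRow m n j (p + 1) (p + 1) A (insert p B) := by
  ext ⟨i', j', u⟩
  cases u
  · simp only [Finset.mem_sdiff, mem_partialRow_down hβ, Finset.mem_insert,
      Finset.mem_singleton, UnitTriangle.mk.injEq, Bool.false_eq_true, and_false, and_true, or_false,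
      imp_iff_not_or]
    omega
  · simp only [Finset.mem_sdiff, mem_partialRow_up hβ, Finset.mem_insert,
      Finset.mem_singleton, UnitTriangle.mk.injEq, Bool.true_eq_false, and_false, and_true,
      false_or]
    tauto

/-- The two terms are the two partners left for the down-pointing triangle: the next triangle of its
row, or the one above it. The vertical choice is recorded in `B` and makes the next up-pointing
triangle the front of the sweep. -/
theorem weightedTilings_partialRow_down (hβ : 1 ≤ baseSide m n)
    (hw : IsAxisWeight w (baseSide m n) x) (hj : (m : ℤ) ≤ j) (hj' : j + 1 ≤ 2 * m) {p : ℤ}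
    (hp : p ∉ B) (hl : baseSide m n ≤ 2 * p + j + 1) (hr : p + 2 + j ≤ m + baseSide m n) :
    weightedTilings (partialRow m n j (p + 1) p A B) w =
      (if p + 1 ∉ A then weightedTilings (partialRow m n j (p + 2) (p + 1) A B) w else 0) +
      if j + 2 ≤ 2 * m then (if 2 * p + j + 1 = baseSide m n then x else 1) *
        weightedTilings (partialRow m n j (p + 1) (p + 1) A (insert p B)) w else 0 := by
  rw [weightedTilings_expand_down (i := p) (j := j)]
  · have h1 : (⟨p + 1, j, true⟩ : UnitTriangle) ∈ partialRow m n j (p + 1) p A B ↔ p + 1 ∉ A := by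
      rw [mem_partialRow_up hβ]; grind
    have h2 : (⟨p, j + 1, true⟩ : UnitTriangle) ∈ partialRow m n j (p + 1) p A B ↔
        j + 2 ≤ 2 * m := by
      rw [mem_partialRow_up hβ]; grind
    simp only [h1, h2, hw.left, hw.vertical, one_mul, partialRow_sdiff_left hβ,
      partialRow_sdiff_vertical hβ]
  · rw [mem_partialRow_down hβ]; grind
  · rw [mem_partialRow_up hβ]; grind

/-- Forced tiles to the left of a removed triangle. -/
theorem weightedTilings_partialRow_forced (hβ : 1 ≤ baseSide m n)
    (hw : IsAxisWeight w (baseSide m n) x) (hj : (m : ℤ) ≤ j) (hj' : j + 1 ≤ 2 * m) {a : ℤ}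
    (ha : a ∈ A) (hr : a + 1 + j ≤ m + baseSide m n) (p : ℤ) (hpa : p ≤ a)
    (hl : baseSide m n ≤ 2 * p + j) (hA : ∀ q, p ≤ q → q < a → q ∉ A) :
    weightedTilings (partialRow m n j p p A B) w =
      weightedTilings (partialRow m n j (a + 1) a A B) w := by
  induction p, hpa using Int.leInductionDown with
  | base => rw [partialRow_of_mem hβ ha]
  | pred p hpa ih =>
    rw [weightedTilings_partialRow_up hβ hw hj hj' (hA _ le_rfl (by omega)) hl (by omega),
      if_pos (by omega), sub_add_cancel, ih (by omega) fun q hq => hA q (by omega)]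

/-- Forced pairings run to the right end of the row, where the last up-pointing triangle has no
partner. -/
theorem weightedTilings_partialRow_eq_zero (hβ : 1 ≤ baseSide m n)
    (hw : IsAxisWeight w (baseSide m n) x) (hj : (m : ℤ) ≤ j) (hj' : j + 1 ≤ 2 * m)
    (p : ℤ) (hp : p ≤ m + baseSide m n - j - 1)
    (hl : baseSide m n ≤ 2 * p + j) (hA : ∀ q, p ≤ q → q ∉ A) :
    weightedTilings (partialRow m n j p p A B) w = 0 := by
  induction p, hp using Int.leInductionDown with
  | base =>
    rw [weightedTilings_partialRow_up hβ hw hj hj' (hA _ le_rfl) hl (by omega),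
      if_neg (by omega)]
  | pred p hp ih =>
    rw [weightedTilings_partialRow_up hβ hw hj hj' (hA _ le_rfl) hl (by omega),
      if_pos (by omega), sub_add_cancel, ih (by omega) fun q hq => hA q (by omega)]

/-- A vertical rhombus beyond the last removed triangle would lead to
`weightedTilings_partialRow_eq_zero`, so the rest of the row is forced. -/
theorem weightedTilings_partialRow_last (hβ : 1 ≤ baseSide m n)
    (hw : IsAxisWeight w (baseSide m n) x) (hj : (m : ℤ) ≤ j) (hj' : j + 1 ≤ 2 * m)
    (p : ℤ) (hp : p ≤ m + baseSide m n - j - 1)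
    (hl : baseSide m n ≤ 2 * p + j + 1) (hA : ∀ q, p < q → q ∉ A) (hB : ∀ b ∈ B, b < p) :
    weightedTilings (partialRow m n j (p + 1) p A B) w =
      weightedTilings (above m n (j + 1) B) w := by
  induction p, hp using Int.leInductionDown with
  | base =>
    congr 1
    ext ⟨i', j', u⟩
    cases u
    · simp only [mem_partialRow_down hβ, above, Finset.mem_filter, mem_quarter_down hβ]
      grind
    · simp only [mem_partialRow_up hβ, above, Finset.mem_filter, mem_quarter_up hβ]
      grind
  | pred p hp ih =>
    rw [weightedTilings_partialRow_down hβ hw hj hj' (fun h => absurd (hB _ h) (by omega)) hl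
      (by omega), if_pos (hA _ (by omega)),
      weightedTilings_partialRow_eq_zero hβ hw hj hj' _ (by omega) (by omega)
        fun q hq => hA q (by omega), mul_zero, ite_self, add_zero, sub_add_cancel,
      show p - 1 + 2 = p + 1 by ring,
      ih (by omega) (fun q hq => hA q (by omega)) fun b hb => (hB b hb).trans (by omega)]

/-- The index `b` is the place of the only vertical rhombus before `a`: up to it every down-pointing
triangle takes its right neighbour, and after it the pairings are forced until the removed triangle
at `a`. -/
theorem weightedTilings_partialRow_gap (hβ : 1 ≤ baseSide m n)
    (hw : IsAxisWeight w (baseSide m n) x) (hj : (m : ℤ) ≤ j) (hj' : j + 2 ≤ 2 * m) {a : ℤ}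
    (ha : a ∈ A) (hr : a + 1 + j ≤ m + baseSide m n) (p : ℤ) (hpa : p ≤ a - 1)
    (hl : baseSide m n ≤ 2 * p + j + 1) (hA : ∀ q, p < q → q < a → q ∉ A)
    (hB : ∀ b ∈ B, b < p) :
    weightedTilings (partialRow m n j (p + 1) p A B) w =
      ∑ b ∈ Finset.Ico p a, (if 2 * b + j + 1 = baseSide m n then x else 1) *
        weightedTilings (partialRow m n j (a + 1) a A (insert b B)) w := by
  induction p, hpa using Int.leInductionDown with
  | base =>
    rw [weightedTilings_partialRow_down hβ hw hj (by omega) (fun h => absurd (hB _ h) (by omega)) hl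
      (by omega), if_neg (by simpa using ha), if_pos hj', zero_add, sub_add_cancel,
      partialRow_of_mem hβ ha]
    have : Finset.Ico (a - 1) a = {a - 1} := by ext; simp; omega
    rw [this, Finset.sum_singleton]
  | pred p hp ih =>
    rw [weightedTilings_partialRow_down hβ hw hj (by omega) (fun h => absurd (hB _ h) (by omega)) hl
      (by omega), if_pos (hA _ (by omega) (by omega)), if_pos hj', sub_add_cancel,
      show p - 1 + 2 = p + 1 by ring,
      ih (by omega) (fun q hq => hA q (by omega)) (fun b hb => (hB b hb).trans (by omega)),
      weightedTilings_partialRow_forced hβ hw hj (by omega) ha hr p (by omega) (by omega)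
        (fun q hq => hA q (by omega)), add_comm]
    have : Finset.Ico (p - 1) a = insert (p - 1) (Finset.Ico p a) := by
      ext; simp; omega
    rw [this, Finset.sum_insert (by simp)]

/-- The transfer from a row to the next one: the vertical rhombi between them interlace with the
removed triangles. -/
theorem weightedTilings_partialRow_interlace (hβ : 1 ≤ baseSide m n)
    (hw : IsAxisWeight w (baseSide m n) x) (hj : (m : ℤ) ≤ j) (hj' : j + 1 ≤ 2 * m) (k : ℕ)
    (hk : j + 2 ≤ 2 * m ∨ k = 0) (a : Fin (k + 1) → ℤ) (ha : StrictMono a)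
    (hr : ∀ i, a i + 1 + j ≤ m + baseSide m n) (hl : baseSide m n ≤ 2 * a 0 + j + 1)
    (hA : ∀ q, a 0 < q → (q ∈ A ↔ ∃ i, a i = q)) (hB : ∀ b ∈ B, b < a 0) :
    weightedTilings (partialRow m n j (a 0 + 1) (a 0) A B) w =
      ∑ b ∈ Fintype.piFinset fun i : Fin k => Finset.Ico (a i.castSucc) (a i.succ),
        (∏ i, if 2 * b i + j + 1 = baseSide m n then x else 1) *
          weightedTilings (above m n (j + 1) (B ∪ Finset.univ.image b)) w := by
  induction k generalizing B with
  | zero =>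
    rw [weightedTilings_partialRow_last hβ hw hj hj' _ (by linarith [hr 0]) hl _ hB]
    · simp
    · intro q hq
      rw [hA q hq]
      rintro ⟨i, rfl⟩
      rw [Fin.fin_one_eq_zero i] at hq
      exact lt_irrefl _ hq
  | succ k ih =>
    have h01 : a 0 < a 1 := ha (by simp)
    rw [weightedTilings_partialRow_gap hβ hw hj (by omega) ((hA (a 1) h01).2 ⟨1, rfl⟩) (hr 1) (a 0)
      (by omega) hl _ hB]
    -- The induction hypothesis is applied to the tail of `a`, with `b` moved into `B` and `A`
    -- unchanged. This is why `A` is only prescribed to the right of `a 0`.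
    · have step : ∀ b ∈ Finset.Ico (a 0) (a 1), _ := fun b hb =>
        ih (B := insert b B) (by omega) (fun i => a i.succ) (fun i i' h => ha (by simpa using h))
          (fun i => hr _) (by simp; omega) (by
            intro q hq
            simp only [Fin.succ_zero_eq_one] at hq
            rw [hA q (h01.trans hq)]
            constructor
            · rintro ⟨i, rfl⟩
              obtain ⟨i', rfl⟩ := Fin.exists_succ_eq.2 (show i ≠ 0 by rintro rfl; omega)
              exact ⟨i', rfl⟩
            · rintro ⟨i, rfl⟩
              exact ⟨_, rfl⟩)
          (by
            intro c hc
            rw [Finset.mem_Ico] at hb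
            simp only [Fin.succ_zero_eq_one]
            rcases Finset.mem_insert.1 hc with rfl | hc
            · exact hb.2
            · exact (hB c hc).trans h01)
      simp only [Fin.succ_zero_eq_one] at step
      rw [Finset.sum_congr rfl fun b hb => by rw [step b hb, Finset.mul_sum], Finset.sum_sigma']
      refine Finset.sum_bij' (fun s _ => Fin.cons s.1 s.2) (fun b _ => ⟨b 0, Fin.tail b⟩) ?_ ?_ ?_
        ?_ ?_
      · rintro ⟨b, c⟩ h
        rw [Finset.mem_sigma, Fintype.mem_piFinset] at h
        rw [Fintype.mem_piFinset, Fin.forall_fin_succ]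
        exact ⟨by simpa using h.1, fun i => by simpa using h.2 i⟩
      · intro b h
        rw [Fintype.mem_piFinset, Fin.forall_fin_succ] at h
        rw [Finset.mem_sigma, Fintype.mem_piFinset]
        exact ⟨by simpa using h.1, fun i => by simpa [Fin.tail] using h.2 i⟩
      · rintro ⟨b, c⟩ h
        simp
      · intro b h
        simp
      · rintro ⟨b, c⟩ h
        simp only [Fin.prod_univ_succ, Fin.cons_zero, Fin.cons_succ]
        rw [mul_assoc]
        congr 4
        ext q
        simp [Fin.exists_fin_succ, eq_comm]
        tauto
    · intro q hq hq' hqA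
      obtain ⟨i, rfl⟩ := (hA q hq).1 hqA
      rw [ha.lt_iff_lt] at hq hq'
      rw [Fin.lt_def] at hq hq'
      simp at hq hq'
      omega

end

/-! ### Telescoping sums and row operations on determinants -/

theorem sum_Ico_int_telescope {M : Type*} [AddCommGroup M] (f g : ℤ → M) {r s : ℤ} (hrs : r ≤ s)
    (h : ∀ b, r ≤ b → b < s → f b = g (b + 1) - g b) :
    ∑ b ∈ Finset.Ico r s, f b = g s - g r := by
  induction s, hrs using Int.leInduction with
  | base => simp
  | succ s hrs ih =>
    have : Finset.Ico r (s + 1) = insert s (Finset.Ico r s) := by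
      ext; simp; omega
    rw [this, Finset.sum_insert (by simp), ih fun b hb hb' => h b hb (by omega),
      h s hrs (by omega)]
    abel

theorem strictMono_cons {k : ℕ} {a : Fin k → ℤ} (ha : StrictMono a) {r : ℤ} (hr : ∀ i, r < a i) :
    StrictMono (Fin.cons r a : Fin (k + 1) → ℤ) := by
  intro i i' h
  induction i' using Fin.cases with
  | zero => exact absurd h (Fin.not_lt_zero i)
  | succ i' =>
    induction i using Fin.cases with
    | zero => simpa using hr i'
    | succ i => simpa using ha (Fin.succ_lt_succ_iff.1 h)

/-- Multilinearity in the rows. It applies to interlacing sequences because, for a fixed lower row,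
their entries range over independent intervals. -/
theorem det_of_sum_rows {k : ℕ} (s : Fin k → Finset ℤ) (u : ℤ → ℚ) (f : ℤ → Fin k → ℚ) :
    ∑ b ∈ Fintype.piFinset s, (∏ i, u (b i)) * (Matrix.of fun i => f (b i)).det =
      (Matrix.of fun i l => ∑ b ∈ s i, u b * f b l).det := by
  have h := (Matrix.detRowAlternating (n := Fin k) (R := ℚ)).toMultilinearMap.map_sum_finset
    (fun _ b => u b • f b) s
  have e : (fun i => ∑ b ∈ s i, u b • f b) = fun i l => ∑ b ∈ s i, u b * f b l := by
    ext i l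
    simp [Finset.sum_apply]
  rw [e] at h
  refine Eq.trans (Finset.sum_congr rfl fun b _ => ?_) h.symm
  exact (Matrix.det_mul_column (fun i => u (b i)) (Matrix.of fun i => f (b i))).symm

/-- Subtracting from each row its predecessor preserves the determinant; as `g` vanishes at `r`, the
first difference is the first row itself. -/
theorem det_sub_pred_rows_cons {k : ℕ} (g : ℤ → Fin k → ℚ) (r : ℤ) (hr : g r = 0)
    (a : Fin k → ℤ) :
    (Matrix.of fun i l => g ((Fin.cons r a : Fin (k + 1) → ℤ) i.succ) l -
      g ((Fin.cons r a : Fin (k + 1) → ℤ) i.castSucc) l).det = (Matrix.of fun i => g (a i)).det := by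
  cases k with
  | zero => simp
  | succ k =>
    symm
    refine Matrix.det_eq_of_forall_row_eq_smul_add_pred (fun _ => 1) ?_ ?_
    · intro l
      simp [hr]
    · intro i l
      simp only [Matrix.of_apply, Fin.cons_succ, ← Fin.succ_castSucc]
      ring

/-- Row differences clear the column of ones below its top entry, and expansion along that column
lowers the size by one. -/
theorem det_eq_det_sub_pred_rows {k : ℕ} (M : Matrix (Fin (k + 1)) (Fin (k + 1)) ℚ)
    (h : ∀ i, M i 0 = 1) :
    M.det = (Matrix.of fun i l : Fin k => M i.succ l.succ - M i.castSucc l.succ).det := by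
  have h1 : M.det = (Matrix.of fun i l : Fin (k + 1) =>
      (Fin.cons (M 0 l) (fun i : Fin k => M i.succ l - M i.castSucc l) : Fin (k + 1) → ℚ) i).det := by
    refine Matrix.det_eq_of_forall_row_eq_smul_add_pred (fun _ => 1) ?_ ?_
    · intro l
      simp
    · intro i l
      simp
  rw [h1, Matrix.det_succ_column_zero, Fin.sum_univ_succ, Finset.sum_eq_zero]
  · simp [h]
    congr 1
  · intro i _
    simp [h]

/-! ### The determinant attached to each row -/

/-- Functions on the positions of a row given by iterated summation of the constant `1`,
the value at the first position being multiplied by `x` in every second summation. -/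
structure IsIteratedSum (x : ℚ) (e o : ℕ → ℤ → ℚ) : Prop where
  zero : ∀ p, e 0 p = 1
  odd_one : ∀ c, o c 1 = x * e c 1
  odd_succ : ∀ c p, 1 ≤ p → o c (p + 1) - o c p = e c (p + 1)
  even_succ : ∀ c p, 1 ≤ p → e (c + 1) (p + 1) - e (c + 1) p = o c p

/-- The abscissa of the leftmost up-pointing triangle at height `j`. -/
def leftEnd (m n : ℕ) (j : ℤ) : ℤ := (baseSide m n - j + 1) / 2

section
variable {m n : ℕ} {w : Finset UnitTriangle → ℚ} {x : ℚ} {e o : ℕ → ℤ → ℚ}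

theorem baseSide_emod_two : baseSide m n % 2 = 1 := by
  unfold baseSide; omega

/-- The row begins with an up-pointing triangle, so the tiles before `a 0` are forced and no
vertical rhombus touches the axis. The new column `e 0 = 1` absorbs the change of size, through
`det_eq_det_sub_pred_rows`. -/
theorem weightedTilings_above_odd_step (hβ : 1 ≤ baseSide m n)
    (hw : IsAxisWeight w (baseSide m n) x) (h : IsIteratedSum x e o) (c : ℕ) (j : ℤ)
    (hc : j = 2 * m - 2 * c - 1) (hj : (m : ℤ) ≤ j)
    (ih : ∀ b : Fin c → ℤ, StrictMono b → (∀ i, leftEnd m n (j + 1) ≤ b i) →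
      (∀ i, b i + 1 + (j + 1) ≤ m + baseSide m n) →
      weightedTilings (above m n (j + 1) (Finset.univ.image b)) w =
        (Matrix.of fun i l : Fin c => o l (b i - leftEnd m n (j + 1) + 1)).det)
    (a : Fin (c + 1) → ℤ) (ha : StrictMono a) (hl : ∀ i, leftEnd m n j ≤ a i)
    (hr : ∀ i, a i + 1 + j ≤ m + baseSide m n) :
    weightedTilings (above m n j (Finset.univ.image a)) w =
      (Matrix.of fun i l : Fin (c + 1) => e l (a i - leftEnd m n j + 1)).det := by
  have hodd := baseSide_emod_two (m := m) (n := n)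
  obtain ⟨L, hL⟩ : ∃ L, leftEnd m n j = L := ⟨_, rfl⟩
  have hL1 : leftEnd m n (j + 1) = L := by rw [← hL]; unfold leftEnd; omega
  have hL2 : baseSide m n = 2 * L + j := by rw [← hL]; unfold leftEnd; omega
  simp only [hL1] at ih
  simp only [hL] at hl ⊢
  have h1 : above m n j (Finset.univ.image a) =
      partialRow m n j L L (Finset.univ.image a) ∅ := by
    ext ⟨i', j', u⟩
    cases u
    · simp only [mem_partialRow_down hβ, above, Finset.mem_filter, mem_quarter_down hβ]
      grind
    · simp only [mem_partialRow_up hβ, above, Finset.mem_filter, mem_quarter_up hβ]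
      grind
  rw [h1, weightedTilings_partialRow_forced hβ hw hj (by omega)
      (Finset.mem_image_of_mem a (Finset.mem_univ 0)) (hr 0) L (hl 0) (by omega),
    weightedTilings_partialRow_interlace hβ hw hj (by omega) c (by omega) a ha hr
      (by have := hl 0; omega) (by simp) (by simp)]
  · have h2 : ∀ b ∈ Fintype.piFinset fun i : Fin c => Finset.Ico (a i.castSucc) (a i.succ),
        (∏ i, if 2 * b i + j + 1 = baseSide m n then x else 1) *
          weightedTilings (above m n (j + 1) (∅ ∪ Finset.univ.image b)) w =
        (∏ i, (fun _ => 1 : ℤ → ℚ) (b i)) *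
          (Matrix.of fun i : Fin c => (fun p (l : Fin c) => o l (p - L + 1)) (b i)).det := by
      intro b hb
      simp only [Fintype.mem_piFinset, Finset.mem_Ico] at hb
      rw [Finset.empty_union, ih b]
      · congr 1
        exact Finset.prod_congr rfl fun i _ => if_neg (by omega)
      · intro i i' hii
        have : a i.succ ≤ a i'.castSucc := ha.monotone (by
          rw [Fin.le_def]; simpa using hii)
        exact ((hb i).2.trans_le this).trans_le (hb i').1
      · intro i
        exact (hl _).trans (hb i).1
      · intro i
        have := hr i.succ
        have := (hb i).2
        omega
    refine ((Finset.sum_congr rfl h2).trans (det_of_sum_rows _ (fun _ => 1)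
      fun p (l : Fin c) => o l (p - L + 1))).trans ?_
    rw [det_eq_det_sub_pred_rows]
    · congr 2
      ext i l
      simp only [one_mul, Matrix.of_apply, Fin.val_succ]
      rw [sum_Ico_int_telescope _ (fun p => e (l + 1) (p - L + 1)) (ha.monotone (Fin.castSucc_lt_succ).le)]
      intro b hb _
      have := hl i.castSucc
      rw [← h.even_succ _ _ (by omega)]
      congr 2
      ring
    · intro i
      simp [h.zero]
  · intro q _ hq
    simp only [Finset.mem_image, Finset.mem_univ, true_and, not_exists]
    rintro i rfl
    exact absurd hq (not_lt.2 (ha.monotone (Fin.zero_le i)))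

/-- The row begins with a down-pointing triangle touching the axis. Its first vertical rhombus may
have weight `x`, and the size of the determinant does not change. -/
theorem weightedTilings_above_even_step (hβ : 1 ≤ baseSide m n)
    (hw : IsAxisWeight w (baseSide m n) x) (h : IsIteratedSum x e o) (c : ℕ) (j : ℤ)
    (hc : j = 2 * m - 2 * c - 2) (hj : (m : ℤ) ≤ j)
    (ih : ∀ b : Fin (c + 1) → ℤ, StrictMono b → (∀ i, leftEnd m n (j + 1) ≤ b i) →
      (∀ i, b i + 1 + (j + 1) ≤ m + baseSide m n) →
      weightedTilings (above m n (j + 1) (Finset.univ.image b)) w =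
        (Matrix.of fun i l : Fin (c + 1) => e l (b i - leftEnd m n (j + 1) + 1)).det)
    (a : Fin (c + 1) → ℤ) (ha : StrictMono a) (hl : ∀ i, leftEnd m n j ≤ a i)
    (hr : ∀ i, a i + 1 + j ≤ m + baseSide m n) :
    weightedTilings (above m n j (Finset.univ.image a)) w =
      (Matrix.of fun i l : Fin (c + 1) => o l (a i - leftEnd m n j + 1)).det := by
  have hodd := baseSide_emod_two (m := m) (n := n)
  obtain ⟨L, hL⟩ : ∃ L, leftEnd m n j = L := ⟨_, rfl⟩
  have hL1 : leftEnd m n (j + 1) = L - 1 := by rw [← hL]; unfold leftEnd; omega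
  have hL2 : baseSide m n = 2 * L + j - 1 := by rw [← hL]; unfold leftEnd; omega
  simp only [hL1] at ih
  simp only [hL] at hl ⊢
  have h1 : above m n j (Finset.univ.image a) =
      partialRow m n j L (L - 1) (Finset.univ.image a) ∅ := by
    ext ⟨i', j', u⟩
    cases u
    · simp only [mem_partialRow_down hβ, above, Finset.mem_filter, mem_quarter_down hβ]
      grind
    · simp only [mem_partialRow_up hβ, above, Finset.mem_filter, mem_quarter_up hβ]
      grind
  -- The entry `L - 1` is a virtual removed triangle just outside the row: the sweep starts in the
  -- state that follows a removal there.
  set a' : Fin (c + 2) → ℤ := Fin.cons (L - 1) a with ha'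
  have ha'm : StrictMono a' := by
    exact strictMono_cons ha fun i => by have := hl i; omega
  have hl' : ∀ i, L - 1 ≤ a' i := fun i => ha'm.monotone (Fin.zero_le i)
  have hr' : ∀ i, a' i + 1 + j ≤ m + baseSide m n := by
    intro i
    have h1 := ha'm.monotone (Fin.le_last i)
    have h2 := hr (Fin.last c)
    have h3 : a' (Fin.last (c + 1)) = a (Fin.last c) := by
      rw [ha', ← Fin.succ_last, Fin.cons_succ]
    omega
  have key := weightedTilings_partialRow_interlace (A := Finset.univ.image a) (B := ∅) hβ hw hj
    (by omega) (c + 1) (by omega) a' ha'm hr' (by simp [ha']; omega)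
    (by
      intro q hq
      rw [Fin.exists_fin_succ]
      simp only [ha', Fin.cons_zero, Fin.cons_succ] at hq ⊢
      simp [hq.ne]) (by simp)
  have h0 : a' 0 = L - 1 := rfl
  rw [h0, sub_add_cancel] at key
  rw [h1, key]
  have h2 : ∀ b ∈ Fintype.piFinset fun i : Fin (c + 1) => Finset.Ico (a' i.castSucc) (a' i.succ),
      (∏ i, if 2 * b i + j + 1 = baseSide m n then x else 1) *
        weightedTilings (above m n (j + 1) (∅ ∪ Finset.univ.image b)) w =
      (∏ i, (fun p => if p = L - 1 then x else 1 : ℤ → ℚ) (b i)) *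
        (Matrix.of fun i : Fin (c + 1) => (fun p (l : Fin (c + 1)) => e l (p - (L - 1) + 1))
          (b i)).det := by
    intro b hb
    simp only [Fintype.mem_piFinset, Finset.mem_Ico] at hb
    rw [Finset.empty_union, ih b]
    · congr 1
      exact Finset.prod_congr rfl fun i _ => if_congr (by omega) rfl rfl
    · intro i i' hii
      have : a' i.succ ≤ a' i'.castSucc := ha'm.monotone (by
        rw [Fin.le_def]; simpa using hii)
      exact ((hb i).2.trans_le this).trans_le (hb i').1
    · intro i
      exact (hl' _).trans (hb i).1
    · intro i
      have := hr' i.succ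
      have := (hb i).2
      omega
  refine ((Finset.sum_congr rfl h2).trans (det_of_sum_rows _
    (fun p => if p = L - 1 then x else 1)
    fun p (l : Fin (c + 1)) => e l (p - (L - 1) + 1))).trans ?_
  -- The telescoping function is set to 0 at `L - 1`, since `o l 0` need not vanish (it is -1/2 for
  -- `l = 0`, `x = 1/2`). Its first jump is then `o l 1 = x * e l 1`, the weighted axis term.
  have h3 : (Matrix.of fun i l : Fin (c + 1) => o l (a i - L + 1)).det =
      (Matrix.of fun i => (fun (p : ℤ) (l : Fin (c + 1)) =>
        if p = L - 1 then 0 else o l (p - L + 1)) (a i)).det := by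
    congr 2
    ext i l
    simp only
    rw [if_neg]
    have := hl i
    omega
  rw [h3]
  refine Eq.trans ?_ (det_sub_pred_rows_cons (fun (p : ℤ) (l : Fin (c + 1)) =>
    if p = L - 1 then 0 else o l (p - L + 1)) (L - 1) (by ext; simp) a)
  congr 2
  ext i l
  rw [sum_Ico_int_telescope _ (fun p => if p = L - 1 then 0 else o l (p - L + 1))
    (ha'm.monotone (Fin.castSucc_lt_succ).le)]
  intro b hb _
  have := hl' i.castSucc
  split_ifs with hb1 hb2 hb2
  · omega
  · subst hb1
    simpa using (h.odd_one l).symm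
  · omega
  · have := h.odd_succ l (b - L + 1) (by omega)
    rw [show b + 1 - L + 1 = b - L + 1 + 1 by ring, this, one_mul]
    congr 1
    ring

theorem weightedTilings_above_eq_det (hβ : 1 ≤ baseSide m n)
    (hw : IsAxisWeight w (baseSide m n) x) (h : IsIteratedSum x e o) (c : ℕ) :
    (∀ j : ℤ, j = 2 * m - 2 * c → (m : ℤ) ≤ j → ∀ a : Fin c → ℤ, StrictMono a →
      (∀ i, leftEnd m n j ≤ a i) → (∀ i, a i + 1 + j ≤ m + baseSide m n) →
      weightedTilings (above m n j (Finset.univ.image a)) w =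
        (Matrix.of fun i l : Fin c => o l (a i - leftEnd m n j + 1)).det) ∧
    (∀ j : ℤ, j = 2 * m - 2 * c - 1 → (m : ℤ) ≤ j → ∀ a : Fin (c + 1) → ℤ, StrictMono a →
      (∀ i, leftEnd m n j ≤ a i) → (∀ i, a i + 1 + j ≤ m + baseSide m n) →
      weightedTilings (above m n j (Finset.univ.image a)) w =
        (Matrix.of fun i l : Fin (c + 1) => e l (a i - leftEnd m n j + 1)).det) := by
  have odd_of_even : ∀ c : ℕ, (∀ j : ℤ, j = 2 * m - 2 * c → (m : ℤ) ≤ j → ∀ a : Fin c → ℤ,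
      StrictMono a → (∀ i, leftEnd m n j ≤ a i) → (∀ i, a i + 1 + j ≤ m + baseSide m n) →
      weightedTilings (above m n j (Finset.univ.image a)) w =
        (Matrix.of fun i l : Fin c => o l (a i - leftEnd m n j + 1)).det) → _ :=
    fun c hc j hj hj' => weightedTilings_above_odd_step hβ hw h c j hj hj'
      (hc (j + 1) (by omega) (by omega))
  induction c with
  | zero =>
    -- Both goals concern height `2 * m`, above which nothing of the quarter remains.
    refine ⟨?_, odd_of_even 0 ?_⟩
    all_goals
      intro j hj _ a _ _ _
      have : above m n j (Finset.univ.image a) = ∅ := by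
        refine Finset.eq_empty_of_forall_notMem ?_
        rintro ⟨i', j', u⟩
        cases u
        · simp only [above, Finset.mem_filter, mem_quarter_down hβ]
          grind
        · simp only [above, Finset.mem_filter, mem_quarter_up hβ]
          grind
      rw [this, weightedTilings_empty, Matrix.det_fin_zero]
  | succ c ih =>
    have h1 := fun (j : ℤ) (hj : j = 2 * m - 2 * ((c + 1 : ℕ) : ℤ)) (hj' : (m : ℤ) ≤ j) =>
      weightedTilings_above_even_step hβ hw h c j (by push_cast at hj; omega) hj'
        (ih.2 (j + 1) (by push_cast at hj; omega) (by omega))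
    exact ⟨h1, odd_of_even (c + 1) h1⟩

end

/-! ### Closed forms of the iterated sums -/

/-- The recursions are Pascal's rule for C(p+c-1, 2c) and C(p+c, 2c+1). The factors are paired
symmetrically to display polynomials in p(p-1) and p². -/
theorem isIteratedSum_one : IsIteratedSum 1
    (fun c p => (∏ l ∈ Finset.range c, ((p : ℚ) * (p - 1) - l * (l + 1))) / (2 * c).factorial)
    (fun c p => p * (∏ l ∈ Finset.range c, ((p : ℚ) ^ 2 - (l + 1) ^ 2)) /
      (2 * c + 1).factorial) := by
  -- The left side is the product of the consecutive factors q-c, ..., q+c; `key1` splits off the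
  -- largest factor and `key2` the smallest.
  have key1 : ∀ (c : ℕ) (q : ℚ), q * ∏ l ∈ Finset.range c, (q ^ 2 - ((l : ℚ) + 1) ^ 2) =
      (q + c) * ∏ l ∈ Finset.range c, (q * (q - 1) - (l : ℚ) * (l + 1)) := by
    intro c q
    induction c with
    | zero => simp
    | succ c ih =>
      rw [Finset.prod_range_succ, Finset.prod_range_succ]
      push_cast
      linear_combination (q ^ 2 - ((c : ℚ) + 1) ^ 2) * ih
  have key2 : ∀ (c : ℕ) (q : ℚ), q * ∏ l ∈ Finset.range c, (q ^ 2 - ((l : ℚ) + 1) ^ 2) =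
      (q - c) * ∏ l ∈ Finset.range c, ((q + 1) * (q + 1 - 1) - (l : ℚ) * (l + 1)) := by
    intro c q
    induction c with
    | zero => simp
    | succ c ih =>
      rw [Finset.prod_range_succ, Finset.prod_range_succ]
      push_cast
      linear_combination (q ^ 2 - ((c : ℚ) + 1) ^ 2) * ih
  have hf1 : ∀ c : ℕ, ((2 * c + 1).factorial : ℚ) = (2 * c + 1) * (2 * c).factorial := by
    intro c; rw [Nat.factorial_succ]; push_cast; ring
  have hf2 : ∀ c : ℕ, ((2 * (c + 1)).factorial : ℚ) = (2 * c + 2) * (2 * c + 1).factorial := by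
    intro c; rw [show 2 * (c + 1) = 2 * c + 1 + 1 by ring, Nat.factorial_succ]; push_cast; ring
  have odd_succ : ∀ (c : ℕ) (p : ℤ),
      ((p + 1 : ℤ) : ℚ) * (∏ l ∈ Finset.range c, (((p + 1 : ℤ) : ℚ) ^ 2 - (l + 1) ^ 2)) /
        (2 * c + 1).factorial -
      p * (∏ l ∈ Finset.range c, ((p : ℚ) ^ 2 - (l + 1) ^ 2)) / (2 * c + 1).factorial =
      (∏ l ∈ Finset.range c, (((p + 1 : ℤ) : ℚ) * (((p + 1 : ℤ) : ℚ) - 1) - l * (l + 1))) /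
        (2 * c).factorial := by
    intro c p
    have h0 : ((2 * c).factorial : ℚ) ≠ 0 := by positivity
    have h1 : (2 * c + 1 : ℚ) ≠ 0 := by positivity
    rw [hf1, key1, key2]
    push_cast
    field_simp
    ring
  refine ⟨fun p => by simp, fun c => ?_, fun c p _ => odd_succ c p, fun c p _ => ?_⟩
  -- For `x = 1` the axis is not special: the recursion extends to `p = 0`, where `o c` vanishes.
  · have := odd_succ c 0
    simpa using this
  · have h0 : ((2 * c + 1).factorial : ℚ) ≠ 0 := by positivity
    have h1 : (2 * c + 2 : ℚ) ≠ 0 := by positivity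
    have e1 := key1 c p
    have e2 := key2 c p
    simp only [Finset.prod_range_succ, hf2]
    push_cast
    rw [div_sub_div_same, div_eq_div_iff (by positivity) h0]
    linear_combination ((2 * c + 1).factorial : ℚ) * (((p : ℚ) - 1 - c) * e1 - (p + c + 1) * e2)

/-- Averaging the functions of `isIteratedSum_one` at p and p-1 keeps the difference equations and
halves the initial value at the axis. The average again factors completely. -/
theorem isIteratedSum_half : IsIteratedSum (1 / 2)
    (fun c p => (∏ l ∈ Finset.range c, (((p : ℚ) - 1) ^ 2 - (l : ℚ) ^ 2)) / (2 * c).factorial)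
    (fun c p => (p - 1 / 2) * (∏ l ∈ Finset.range c, ((p : ℚ) * (p - 1) - l * (l + 1))) /
      (2 * c + 1).factorial) := by
  have key1 : ∀ (c : ℕ) (q : ℚ), q * ∏ l ∈ Finset.range c, ((q + 1) * q - (l : ℚ) * (l + 1)) =
      (q + c) * ∏ l ∈ Finset.range c, (q ^ 2 - (l : ℚ) ^ 2) := by
    intro c q
    induction c with
    | zero => simp
    | succ c ih =>
      rw [Finset.prod_range_succ, Finset.prod_range_succ]
      push_cast
      linear_combination ((q + 1) * q - (c : ℚ) * (c + 1)) * ih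
  have key2 : ∀ (c : ℕ) (q : ℚ), q * ∏ l ∈ Finset.range c, (q * (q - 1) - (l : ℚ) * (l + 1)) =
      (q - c) * ∏ l ∈ Finset.range c, (q ^ 2 - (l : ℚ) ^ 2) := by
    intro c q
    induction c with
    | zero => simp
    | succ c ih =>
      rw [Finset.prod_range_succ, Finset.prod_range_succ]
      push_cast
      linear_combination (q * (q - 1) - (c : ℚ) * (c + 1)) * ih
  have key3 : ∀ (c : ℕ) (q : ℚ), ∏ l ∈ Finset.range (c + 1), (q ^ 2 - (l : ℚ) ^ 2) =
      q * (q + c) * ∏ l ∈ Finset.range c, (q * (q - 1) - (l : ℚ) * (l + 1)) := by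
    intro c q
    rw [Finset.prod_range_succ]
    linear_combination -(q + c) * key2 c q
  have key4 : ∀ (c : ℕ) (q : ℚ), ∏ l ∈ Finset.range (c + 1), ((q - 1) ^ 2 - (l : ℚ) ^ 2) =
      (q - 1) * (q - 1 - c) * ∏ l ∈ Finset.range c, (q * (q - 1) - (l : ℚ) * (l + 1)) := by
    intro c q
    have := key1 c (q - 1)
    rw [sub_add_cancel] at this
    rw [Finset.prod_range_succ]
    linear_combination -(q - 1 - c) * this
  refine ⟨fun p => by simp, fun c => ?_, fun c p hp => ?_, fun c p _ => ?_⟩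
  · cases c with
    | zero => norm_num
    | succ c =>
      -- At position 1 both products contain the factor with `l = 0`, which is 0.
      simp [Finset.prod_range_succ']
  · have h0 : ((2 * c).factorial : ℚ) ≠ 0 := by positivity
    have h1 : (2 * c + 1 : ℚ) ≠ 0 := by positivity
    -- `key1` and `key2` carry an extra factor `q` on the left, to be cancelled at the end.
    have hp' : (p : ℚ) ≠ 0 := by
      have : p ≠ 0 := by omega
      exact_mod_cast this
    have e1 := key1 c p
    have e2 := key2 c p
    have hf1 : ((2 * c + 1).factorial : ℚ) = (2 * c + 1) * (2 * c).factorial := by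
      rw [Nat.factorial_succ]; push_cast; ring
    simp only [hf1]
    push_cast
    simp only [add_sub_cancel_right]
    rw [div_sub_div_same, div_eq_div_iff (by positivity) h0]
    refine mul_left_cancel₀ hp' ?_
    linear_combination ((2 * c).factorial : ℚ) * (((p : ℚ) + 1 / 2) * e1 - (p - 1 / 2) * e2)
  · have h0 : ((2 * c + 1).factorial : ℚ) ≠ 0 := by positivity
    have hf2 : ((2 * (c + 1)).factorial : ℚ) = (2 * c + 2) * (2 * c + 1).factorial := by
      rw [show 2 * (c + 1) = 2 * c + 1 + 1 by ring, Nat.factorial_succ]; push_cast; ring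
    simp only [hf2]
    push_cast
    rw [add_sub_cancel_right, key3, key4, div_sub_div_same, div_eq_div_iff (by positivity) h0]
    ring

/-! ### Vandermonde evaluation -/

open Polynomial in
-- Column `l` evaluates a monic polynomial of degree `l`, and passing to such a basis from the
-- monomials is unitriangular.
theorem det_prod_sub {k : ℕ} (y : Fin k → ℚ) (r : ℕ → ℚ) :
    (Matrix.of fun i l : Fin k => ∏ s ∈ Finset.range l, (y i - r s)).det =
      ∏ i, ∏ j ∈ Finset.Ioi i, (y j - y i) := by
  rw [← Matrix.det_vandermonde, Matrix.det_eval_matrixOfPolynomials_eq_det_vandermonde y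
    (fun l => ∏ s ∈ Finset.range l, (X - C (r s)))]
  · simp [eval_prod]
  · intro l
    rw [natDegree_prod_of_monic _ _ fun s _ => monic_X_sub_C _]
    simp
  · intro l
    exact monic_prod_of_monic _ _ fun s _ => monic_X_sub_C _

theorem det_mul_prod_sub_div {k : ℕ} (u y : Fin k → ℚ) (r d : ℕ → ℚ) :
    (Matrix.of fun i l : Fin k => u i * (∏ s ∈ Finset.range l, (y i - r s)) / d l).det =
      (∏ i, u i) / (∏ l ∈ Finset.range k, d l) * ∏ i, ∏ j ∈ Finset.Ioi i, (y j - y i) := by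
  have h1 := Matrix.det_mul_column u (Matrix.of fun i l : Fin k =>
    ∏ s ∈ Finset.range l, (y i - r s))
  have h2 := Matrix.det_mul_row (fun l : Fin k => (d l)⁻¹) (Matrix.of fun i l : Fin k =>
    u i * ∏ s ∈ Finset.range l, (y i - r s))
  simp only [Matrix.of_apply] at h1 h2
  rw [h1, det_prod_sub] at h2
  rw [← Fin.prod_univ_eq_prod_range]
  refine Eq.trans ?_ (h2.trans ?_)
  · congr 2
    ext i l
    rw [div_eq_inv_mul]
  · rw [Finset.prod_inv_distrib]
    ring

/-! ### The weights and regions of the theorem -/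

theorem isAxisWeight_one (β : ℤ) : IsAxisWeight (fun _ => 1) β 1 :=
  ⟨fun _ _ => rfl, fun _ _ => rfl, fun _ _ => (ite_self _).symm⟩

theorem isAxisWeight_leftWeight (m n : ℕ) :
    IsAxisWeight (leftWeight m n) (baseSide m n) (1 / 2) := by
  refine ⟨fun i j => ?_, fun i j => ?_, fun i j => ?_⟩
  · refine if_neg ?_
    simp [IsLeftVertical]
  · refine if_neg ?_
    simp [IsLeftVertical]
  · refine if_congr ?_ rfl rfl
    simp [IsLeftVertical, add_assoc]

theorem position_eq {h L M : ℤ} {R : Finset UnitTriangle}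
    (hR : ∀ i, (⟨i, h, true⟩ : UnitTriangle) ∈ R ↔ L ≤ i ∧ i ≤ M) {i : ℤ}
    (hi : (⟨i, h, true⟩ : UnitTriangle) ∈ R) :
    (position h R ⟨i, h, true⟩ : ℤ) = i - L + 1 := by
  have : (bottomUp h R).filter (fun s => s.i ≤ i) =
      (Finset.Icc L i).image fun i => ⟨i, h, true⟩ := by
    ext ⟨i', j', u⟩
    simp only [bottomUp, Finset.mem_filter, Finset.mem_image, Finset.mem_Icc,
      UnitTriangle.mk.injEq]
    constructor
    · rintro ⟨⟨h1, rfl, rfl⟩, h2⟩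
      exact ⟨i', ⟨((hR _).1 h1).1, h2⟩, rfl, rfl, rfl⟩
    · rintro ⟨_, ⟨h1, h2⟩, rfl, rfl, rfl⟩
      exact ⟨⟨(hR _).2 ⟨h1, h2.trans ((hR _).1 hi).2⟩, rfl, rfl⟩, h2⟩
  rw [position, this, Finset.card_image_of_injective _ fun a b hab => by simpa using hab,
    Int.card_Icc]
  have := (hR _).1 hi
  omega

/-- The remaining bottom triangles form an interval, so positions are shifted abscissas. Allowing a
nonempty `A` covers the second removal in `QHTrimmed`. -/
theorem removeBottom_above {m n k : ℕ} {A : Finset ℤ} {L M : ℤ}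
    (hR : ∀ i, (⟨i, m, true⟩ : UnitTriangle) ∈ above m n m A ↔ L ≤ i ∧ i ≤ M) (a : Fin k → ℕ) :
    removeBottom m (above m n m A) a =
      above m n m (A ∪ Finset.univ.image fun r => (a r : ℤ) + L - 1) := by
  ext ⟨i, j, u⟩
  by_cases hu : u = true ∧ j = m
  · obtain ⟨rfl, rfl⟩ := hu
    have h1 : (⟨i, m, true⟩ : UnitTriangle) ∈ above m n m
          (A ∪ Finset.univ.image fun r => (a r : ℤ) + L - 1) ↔
        (⟨i, m, true⟩ : UnitTriangle) ∈ above m n m A ∧ ∀ r, (a r : ℤ) + L - 1 ≠ i := by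
      simp [above, and_assoc]
    rw [h1, removeBottom, Finset.mem_filter]
    refine and_congr_right fun hi => ?_
    have hpos := position_eq hR hi
    simp only [bottomUp, Finset.mem_filter, hi, and_self, true_and, not_exists]
    exact forall_congr' fun r => not_congr (by omega)
  · have h1 : ∀ A, (⟨i, j, u⟩ : UnitTriangle) ∈ above m n m A ↔
        (⟨i, j, u⟩ : UnitTriangle) ∈ quarter m n ∧ (m : ℤ) ≤ j := by
      intro A
      simp only [above, Finset.mem_filter]
      tauto
    simp only [removeBottom, bottomUp, Finset.mem_filter, h1]
    tauto

theorem quarter_eq_above {m n : ℕ} (hβ : 1 ≤ baseSide m n) : quarter m n = above m n m ∅ := by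
  ext ⟨i, j, u⟩
  cases u
  · simp only [above, Finset.mem_filter, mem_quarter_down hβ]
    grind
  · simp only [above, Finset.mem_filter, mem_quarter_up hβ]
    grind

theorem removeBottom_quarter {m n k : ℕ} (hβ : 1 ≤ baseSide m n) (hm : 1 ≤ m) (a : Fin k → ℕ) :
    removeBottom m (quarter m n) a =
      above m n m (Finset.univ.image fun r => (a r : ℤ) + leftEnd m n m - 1) := by
  rw [quarter_eq_above hβ, removeBottom_above (L := leftEnd m n m) (M := baseSide m n - 1),
    Finset.empty_union]
  intro i
  rw [← quarter_eq_above hβ, mem_quarter_up hβ, leftEnd]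
  omega

/-- After the first removal the row starts one unit further right, so the shift is one larger than
in `removeBottom_quarter`. -/
theorem QHTrimmed_eq_above {m n k : ℕ} (hβ : 1 ≤ baseSide m n) (hm : 1 ≤ m) (a : Fin k → ℕ) :
    QHTrimmed m n a =
      above m n m (Finset.univ.image
        (Fin.cons (leftEnd m n m) fun r => (a r : ℤ) + leftEnd m n m : Fin (k + 1) → ℤ)) := by
  rw [QHTrimmed, removeBottom_quarter hβ hm,
    removeBottom_above (L := leftEnd m n m + 1) (M := baseSide m n - 1)]
  · congr 1
    ext q
    simp only [Finset.mem_union, Finset.mem_image, Finset.mem_univ, true_and, Fin.exists_fin_succ,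
      Fin.cons_zero, Fin.cons_succ]
    refine or_congr (by simp) (exists_congr fun r => by omega)
  · intro i
    simp only [above, Finset.mem_filter, mem_quarter_up hβ, leftEnd, Finset.mem_image,
      Finset.mem_univ, true_and, Fin.exists_fin_one, Matrix.cons_val_fin_one, forall_const]
    omega

/-! ### The four product formulas -/

theorem prod_Ici_eq {k : ℕ} (f : Fin k → Fin k → ℚ) :
    ∏ i, ∏ j ∈ Finset.Ici i, f i j = (∏ i, f i i) * ∏ i, ∏ j ∈ Finset.Ioi i, f i j := by
  rw [← Finset.prod_mul_distrib]
  refine Finset.prod_congr rfl fun i _ => ?_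
  rw [← Finset.Ioi_insert, Finset.prod_insert (by simp)]

theorem weightedTilings_QH_odd {c n : ℕ} (hn : c + 1 < n) {w : Finset UnitTriangle → ℚ} {x : ℚ}
    {e o : ℕ → ℤ → ℚ} (hw : IsAxisWeight w (baseSide (2 * c + 1) n) x) (h : IsIteratedSum x e o)
    (a : Fin (c + 1) → ℕ) (ha : StrictMono a) (ha_pos : ∀ i, 1 ≤ a i) (ha_le : ∀ i, a i ≤ n) :
    weightedTilings (QH (2 * c + 1) n a) w =
      (Matrix.of fun i l : Fin (c + 1) => e l (a i)).det := by
  have hβ : 1 ≤ baseSide (2 * c + 1) n := by unfold baseSide; omega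
  rw [QH, removeBottom_quarter hβ (by omega),
    (weightedTilings_above_eq_det hβ hw h c).2 _ (by push_cast; ring) le_rfl]
  · congr 2
    ext i l
    congr 1
    ring
  · intro i i' hi
    simpa using ha hi
  · intro i
    have := ha_pos i
    omega
  · intro i
    have := ha_le i
    simp only [leftEnd, baseSide]
    omega

theorem weightedTilings_QH_even {c n : ℕ} (hc : 1 ≤ c) (hn : c < n)
    {w : Finset UnitTriangle → ℚ} {x : ℚ}
    {e o : ℕ → ℤ → ℚ} (hw : IsAxisWeight w (baseSide (2 * c) n) x) (h : IsIteratedSum x e o)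
    (a : Fin c → ℕ) (ha : StrictMono a) (ha_pos : ∀ i, 1 ≤ a i) (ha_le : ∀ i, a i ≤ n) :
    weightedTilings (QH (2 * c) n a) w = (Matrix.of fun i l : Fin c => o l (a i)).det := by
  have hβ : 1 ≤ baseSide (2 * c) n := by unfold baseSide; omega
  rw [QH, removeBottom_quarter hβ (by omega),
    (weightedTilings_above_eq_det hβ hw h c).1 _ (by push_cast; ring) le_rfl]
  · congr 2
    ext i l
    congr 1
    ring
  · intro i i' hi
    simpa using ha hi
  · intro i
    have := ha_pos i
    omega
  · intro i
    have := ha_le i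
    simp only [leftEnd, baseSide]
    omega

theorem weightedTilings_QHTrimmed {c n : ℕ} (hn : c < n) {w : Finset UnitTriangle → ℚ} {x : ℚ}
    {e o : ℕ → ℤ → ℚ} (hw : IsAxisWeight w (baseSide (2 * c + 1) n) x) (h : IsIteratedSum x e o)
    (a : Fin c → ℕ) (ha : StrictMono a) (ha_pos : ∀ i, 1 ≤ a i) (ha_le : ∀ i, a i ≤ n - 1) :
    weightedTilings (QHTrimmed (2 * c + 1) n a) w =
      (Matrix.of fun i l : Fin (c + 1) =>
        e l ((Fin.cons 0 fun r => (a r : ℤ) : Fin (c + 1) → ℤ) i + 1)).det := by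
  have hβ : 1 ≤ baseSide (2 * c + 1) n := by unfold baseSide; omega
  rw [QHTrimmed_eq_above hβ (by omega),
    (weightedTilings_above_eq_det hβ hw h c).2 _ (by push_cast; ring) le_rfl]
  · congr 2
    ext i l
    congr 1
    refine Fin.cases ?_ (fun i => ?_) i
    · simp
    · simp
  · refine strictMono_cons (fun i i' hi => by simpa using ha hi) fun i => ?_
    have := ha_pos i
    omega
  · refine Fin.cases ?_ fun i => ?_
    · simp
    · simp
  · refine Fin.cases ?_ fun i => ?_
    · simp only [leftEnd, baseSide, Fin.cons_zero]
      omega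
    · have := ha_le i
      simp only [leftEnd, baseSide, Fin.cons_succ]
      omega

theorem numTilings_QH_odd {k n : ℕ} (hk : 1 ≤ k) (hkn : k < n) (a : Fin k → ℕ)
    (ha : StrictMono a) (ha_pos : ∀ i, 1 ≤ a i) (ha_le : ∀ i, a i ≤ n) :
    (numTilings (QH (2 * k - 1) n a) : ℚ) = (2 : ℚ) ^ (-((k : ℤ) ^ 2)) * E a := by
  obtain ⟨c, rfl⟩ := Nat.exists_eq_add_of_le' hk
  rw [numTilings_eq_weightedTilings, show 2 * (c + 1) - 1 = 2 * c + 1 by omega,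
    weightedTilings_QH_odd hkn (isAxisWeight_one _) isIteratedSum_one a ha ha_pos ha_le]
  have key := det_mul_prod_sub_div (fun _ => 1) (fun i => (a i : ℚ) * (a i - 1))
    (fun s => s * (s + 1)) (fun l => (2 * l).factorial)
  simp only [one_mul, Finset.prod_const_one] at key
  simp only [Int.cast_natCast]
  rw [key, E, zpow_neg]
  have h1 : ∀ i j, (a j : ℚ) * (a j - 1) - a i * (a i - 1) = (a j - a i) * (a i + a j - 1) := by
    intro i j; ring
  have h2 : (2 : ℚ) ^ ((c + 1 : ℕ) : ℤ) ^ 2 = 2 ^ (c + 1) ^ 2 := by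
    rw [← zpow_natCast]; norm_cast
  simp only [h1, Finset.prod_mul_distrib, h2]
  field_simp

theorem numTilings_QH_even {k n : ℕ} (hk : 1 ≤ k) (hkn : k < n) (a : Fin k → ℕ)
    (ha : StrictMono a) (ha_pos : ∀ i, 1 ≤ a i) (ha_le : ∀ i, a i ≤ n) :
    (numTilings (QH (2 * k) n a) : ℚ) = (2 : ℚ) ^ (-((k : ℤ) ^ 2)) * overlineO a := by
  rw [numTilings_eq_weightedTilings,
    weightedTilings_QH_even hk hkn (isAxisWeight_one _) isIteratedSum_one a ha ha_pos ha_le]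
  have key := det_mul_prod_sub_div (fun i => (a i : ℚ)) (fun i => (a i : ℚ) ^ 2)
    (fun s => (s + 1) ^ 2) (fun l => (2 * l + 1).factorial)
  simp only [Int.cast_natCast]
  rw [key, overlineO, zpow_neg]
  have h1 : ∀ i j, (a j : ℚ) ^ 2 - a i ^ 2 = (a j - a i) * (a i + a j) := by
    intro i j; ring
  have h2 : (2 : ℚ) ^ ((k : ℕ) : ℤ) ^ 2 = 2 ^ k ^ 2 := by
    rw [← zpow_natCast]; norm_cast
  simp only [h1, Finset.prod_mul_distrib, h2]
  field_simp

theorem overlineQHOdd_eq {k n : ℕ} (hkn : k < n) (a : Fin k → ℕ)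
    (ha : StrictMono a) (ha_pos : ∀ i, 1 ≤ a i) (ha_le : ∀ i, a i ≤ n - 1) :
    overlineQHOdd (2 * k + 1) n a =
      (2 : ℚ) ^ (-((k : ℤ) * (k + 1))) / ((2 * k).factorial : ℚ) * overlineE a := by
  rw [overlineQHOdd, weightedTilings_QHTrimmed hkn (isAxisWeight_leftWeight _ _)
    isIteratedSum_half a ha ha_pos ha_le]
  -- The triangle trimmed first gives a row with y = 0. Its differences contribute the product of
  -- the `a i ^ 2`, and the additional column contributes `(2 * k)!`.
  have key := det_mul_prod_sub_div (fun _ => 1)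
    (fun i => (((Fin.cons 0 fun r => (a r : ℤ) : Fin (k + 1) → ℤ) i : ℤ) : ℚ) ^ 2)
    (fun s => (s : ℚ) ^ 2) (fun l => (2 * l).factorial)
  simp only [one_mul, Finset.prod_const_one] at key
  simp only [Int.cast_add, Int.cast_one, add_sub_cancel_right]
  rw [key, overlineE, zpow_neg]
  have h1 : ∀ i j, (a j : ℚ) ^ 2 - a i ^ 2 = (a j - a i) * (a i + a j) := by
    intro i j; ring
  have h2 : (2 : ℚ) ^ ((k : ℤ) * (k + 1)) = 2 ^ k ^ 2 * 2 ^ k := by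
    rw [← pow_add, ← zpow_natCast]
    congr 1
    push_cast
    ring
  have h3 : ∏ i, ((a i : ℚ) + a i) = 2 ^ k * ∏ i, (a i : ℚ) := by
    simp only [← two_mul, Finset.prod_mul_distrib, Finset.prod_const, Finset.card_univ,
      Fintype.card_fin]
  rw [Fin.prod_univ_succ, Fin.prod_Ioi_zero, prod_Ici_eq, h3, h2, Finset.prod_range_succ]
  simp only [Fin.prod_Ioi_succ, Fin.cons_zero, Fin.cons_succ, Int.cast_natCast, Int.cast_zero, h1,
    Finset.prod_mul_distrib]
  have h4 : ∏ i ∈ Finset.range k, ((2 * i).factorial : ℚ) ≠ 0 :=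
    Finset.prod_ne_zero_iff.2 fun i _ => by positivity
  simp only [sub_zero, ne_eq, OfNat.ofNat_ne_zero, not_false_eq_true, zero_pow,
    Finset.prod_pow]
  field_simp

theorem overlineQHEven_eq {k n : ℕ} (hk : 1 ≤ k) (hkn : k < n) (a : Fin k → ℕ)
    (ha : StrictMono a) (ha_pos : ∀ i, 1 ≤ a i) (ha_le : ∀ i, a i ≤ n) :
    overlineQHEven (2 * k) n a = (2 : ℚ) ^ (-((k : ℤ) * (k + 1))) * O a := by
  rw [overlineQHEven, weightedTilings_QH_even hk hkn (isAxisWeight_leftWeight _ _)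
    isIteratedSum_half a ha ha_pos ha_le]
  have key := det_mul_prod_sub_div (fun i => (a i : ℚ) - 1 / 2) (fun i => (a i : ℚ) * (a i - 1))
    (fun s => s * (s + 1)) (fun l => (2 * l + 1).factorial)
  simp only [Int.cast_natCast]
  rw [key, O, zpow_neg]
  have h1 : ∀ i j, (a j : ℚ) * (a j - 1) - a i * (a i - 1) = (a j - a i) * (a i + a j - 1) := by
    intro i j; ring
  have h2 : (2 : ℚ) ^ ((k : ℤ) * (k + 1)) = 2 ^ k ^ 2 * 2 ^ k := by
    rw [← pow_add, ← zpow_natCast]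
    congr 1
    push_cast
    ring
  -- The row factors `a i - 1/2` are half the diagonal factors of `O`, which accounts for the extra
  -- `2 ^ k`.
  have h3 : ∏ i, ((a i : ℚ) + a i - 1) = 2 ^ k * ∏ i, ((a i : ℚ) - 1 / 2) := by
    have : ∀ i, (a i : ℚ) + a i - 1 = 2 * (a i - 1 / 2) := fun i => by ring
    simp only [this, Finset.prod_mul_distrib, Finset.prod_const, Finset.card_univ,
      Fintype.card_fin]
  rw [prod_Ici_eq, h3, h2]
  simp only [h1, Finset.prod_mul_distrib]
  generalize ∏ i, ((a i : ℚ) - 1 / 2) = P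
  have h4 : ∏ i ∈ Finset.range k, ((2 * i + 1).factorial : ℚ) ≠ 0 :=
    Finset.prod_ne_zero_iff.2 fun i _ => by positivity
  field_simp

end QuarteredHexagon

theorem mainTheorem3 (k n : ℕ) (hk : 1 ≤ k) (hkn : k < n) (a : Fin k → ℕ)
    (ha : StrictMono a) (ha_pos : ∀ i, 1 ≤ a i) (ha_le : ∀ i, a i ≤ n) :
    (QuarteredHexagon.numTilings (QuarteredHexagon.QH (2 * k - 1) n a) : ℚ) =
        (2 : ℚ) ^ (-((k : ℤ) ^ 2)) * QuarteredHexagon.E a ∧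
    (QuarteredHexagon.numTilings (QuarteredHexagon.QH (2 * k) n a) : ℚ) =
        (2 : ℚ) ^ (-((k : ℤ) ^ 2)) * QuarteredHexagon.overlineO a ∧
    ((∀ i, a i ≤ n - 1) →
      QuarteredHexagon.overlineQHOdd (2 * k + 1) n a =
        (2 : ℚ) ^ (-((k : ℤ) * (k + 1))) / ((2 * k).factorial : ℚ) *
          QuarteredHexagon.overlineE a) ∧
    QuarteredHexagon.overlineQHEven (2 * k) n a =
        (2 : ℚ) ^ (-((k : ℤ) * (k + 1))) * QuarteredHexagon.O a :=
  ⟨QuarteredHexagon.numTilings_QH_odd hk hkn a ha ha_pos ha_le,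
    QuarteredHexagon.numTilings_QH_even hk hkn a ha ha_pos ha_le,
    fun h => QuarteredHexagon.overlineQHOdd_eq hkn a ha ha_pos h,
    QuarteredHexagon.overlineQHEven_eq hk hkn a ha ha_pos ha_le⟩
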